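/- Let $\mathcal C$ be a braided monoidal category with tensor product $\otimes$, unit object $K$ and braiding $c$, which admits equalizers and coequalizers (associativity and unit constraints are suppressed, and we write $H$ for $\mathrm{id}_H$). Let $(H,\eta,\mu)$ be a monoid and $(H,\varepsilon,\delta)$ a comonoid in $\mathcal C$, on the same object $H$, such that (a1) $\delta\circ\mu=(\mu\otimes\mu)\circ(H\otimes c_{H,H}\otimes H)\circ(\delta\otimes\delta)$; (a2) $\varepsilon\circ\mu\circ(\mu\otimes H)=\varepsilon\circ\mu\circ(H\otimes\mu)=((\varepsilon\circ\mu)\otimes(\varepsilon\circ\mu))\circ(H\otimes\delta\otimes H)=((\varepsilon\circ\mu)\otimes(\varepsilon\circ\mu))\circ(H\otimes(c_{H,H}^{-1}\circ\delta)\otimes H)$; (a3) $(\delta\otimes H)\circ\delta\circ\eta=(H\otimes\mu\otimes H)\circ((\delta\circ\eta)\otimes(\delta\circ\eta))=(H\otimes(\mu\circ c_{H,H}^{-1})\otimes H)\circ((\delta\circ\eta)\otimes(\delta\circ\eta))$. Put $\Pi^L=((\varepsilon\circ\mu)\otimes H)\circ(H\otimes c_{H,H})\circ((\delta\circ\eta)\otimes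 H)$ and $\Pi^R=(H\otimes(\varepsilon\circ\mu))\circ(c_{H,H}\otimes H)\circ(H\otimes(\delta\circ\eta))$, and write $a\ast b=\mu\circ(a\otimes b)\circ\delta$ for $a,b:H\to H$. Then $H$ is called a weak Hopf algebra if there is a morphism $\lambda:H\to H$ such that $\mathrm{id}_H\ast\lambda=\Pi^L$, $\lambda\ast\mathrm{id}_H=\Pi^R$, $\lambda\ast\Pi^L=\Pi^R\ast\lambda=\lambda$, and $$\mu\circ(\lambda\otimes\mu)\circ(\delta\otimes H)=\mu\circ(\Pi^R\otimes H),\qquad \mu\circ(H\otimes\mu)\circ(H\otimes\lambda\otimes H)\circ(\delta\otimes H)=\mu\circ(\Pi^L\otimes H),$$ $$\mu\circ(\mu\otimes\lambda)\circ(H\otimes\delta)=\mu\circ(H\otimes\Pi^L),\qquad \mu\circ(\mu\otimes H)\circ(H\otimes\lambda\otimes H)\circ(H\otimes\delta)=\mu\circ(H\otimes\Pi^R)$$ (the last four identities follow from the first two, as $\mu$ is associative). For $\sigma\in\{L,R\}$ let $$\Omega^1_\sigma=(\mu\otimes H)\circ(H\otimes\Pi^\sigma\otimes H)\circ(H\otimes\delta),\qquad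 \Omega^2_\sigma=(H\otimes\mu)\circ(H\otimes\Pi^\sigma\otimes H)\circ(\delta\otimes H).$$ Each of the four morphisms $\Omega^\alpha_\sigma:H\otimes H\to H\otimes H$ ($\alpha\in\{1,2\}$) is a split idempotent: there are an object $H\times^\alpha_\sigma H$ and morphisms $q^\alpha_\sigma:H\otimes H\to H\times^\alpha_\sigma H$, $j^\alpha_\sigma:H\times^\alpha_\sigma H\to H\otimes H$ with $j^\alpha_\sigma\circ q^\alpha_\sigma=\Omega^\alpha_\sigma$ and $q^\alpha_\sigma\circ j^\alpha_\sigma=\mathrm{id}$. Moreover, for every choice of such splittings, the following assertions are equivalent: (i) $H$ is a weak Hopf algebra; (ii) $f=q^1_R\circ\beta\circ j^1_L:H\times^1_LH\to H\times^1_RH$ is an isomorphism, where $\beta=(\mu\otimes H)\circ(H\otimes\delta)$; (iii) $g=q^2_L\circ\gamma\circ j^2_R:H\times^2_RH\to H\times^2_LH$ is an isomorphism, where $\gamma=(H\otimes\mu)\circ(\delta\otimes H)$. -/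

import Mathlib

open CategoryTheory MonoidalCategory MonObj ComonObj

universe v u

namespace WeakHopf

variable {C : Type u} [Category.{v} C] [MonoidalCategory C]

/-- A splitting of an endomorphism `e`: a factorization `e = j ∘ q` with `q ∘ j = id`.
It exists only if `e` is idempotent, and it is then unique up to a unique isomorphism. -/
structure Splitting {Y : C} (e : Y ⟶ Y) where
  /-- The image of the idempotent. -/
  obj : C
  /-- The projection onto the image. -/
  q : Y ⟶ obj
  /-- The inclusion of the image. -/
  j : obj ⟶ Y
  q_j : q ≫ j = e
  j_q : j ≫ q = 𝟙 obj

section Convolution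

variable (H : C) [MonObj H] [ComonObj H]

/-- The convolution product `a ∗ b = μ ∘ (a ⊗ b) ∘ δ` of endomorphisms of `H`. -/
def convolution {H : C} [MonObj H] [ComonObj H] (a b : H ⟶ H) : H ⟶ H :=
  Δ[H] ≫ (a ⊗ₘ b) ≫ μ[H]

/-- The right Galois morphism `(μ ⊗ H) ∘ (H ⊗ δ)`. -/
def galoisRight : H ⊗ H ⟶ H ⊗ H :=
  H ◁ Δ[H] ≫ (α_ H H H).inv ≫ μ[H] ▷ H

/-- The left Galois morphism `(H ⊗ μ) ∘ (δ ⊗ H)`. -/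
def galoisLeft : H ⊗ H ⟶ H ⊗ H :=
  Δ[H] ▷ H ≫ (α_ H H H).hom ≫ H ◁ μ[H]

/-- `(μ ⊗ H) ∘ (H ⊗ P ⊗ H) ∘ (H ⊗ δ)` for an endomorphism `P` of `H`. -/
def omegaOne {H : C} [MonObj H] [ComonObj H] (P : H ⟶ H) : H ⊗ H ⟶ H ⊗ H :=
  H ◁ Δ[H] ≫ H ◁ (P ▷ H) ≫ (α_ H H H).inv ≫ μ[H] ▷ H

/-- `(H ⊗ μ) ∘ (H ⊗ P ⊗ H) ∘ (δ ⊗ H)` for an endomorphism `P` of `H`. -/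
def omegaTwo {H : C} [MonObj H] [ComonObj H] (P : H ⟶ H) : H ⊗ H ⟶ H ⊗ H :=
  Δ[H] ▷ H ≫ (H ◁ P) ▷ H ≫ (α_ H H H).hom ≫ H ◁ μ[H]

end Convolution

variable [BraidedCategory C] (H : C) [MonObj H] [ComonObj H]

/-- The target morphism
`((ε ∘ μ) ⊗ H) ∘ (H ⊗ c) ∘ ((δ ∘ η) ⊗ H)`. -/
def piL : H ⟶ H :=
  (λ_ H).inv ≫ (η[H] ≫ Δ[H]) ▷ H ≫ (α_ H H H).hom ≫ H ◁ (β_ H H).hom ≫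
    (α_ H H H).inv ≫ (μ[H] ≫ ε[H]) ▷ H ≫ (λ_ H).hom

/-- The source morphism
`(H ⊗ (ε ∘ μ)) ∘ (c ⊗ H) ∘ (H ⊗ (δ ∘ η))`. -/
def piR : H ⟶ H :=
  (ρ_ H).inv ≫ H ◁ (η[H] ≫ Δ[H]) ≫ (α_ H H H).inv ≫ (β_ H H).hom ▷ H ≫
    (α_ H H H).hom ≫ H ◁ (μ[H] ≫ ε[H]) ≫ (ρ_ H).hom

/-- The compatibility conditions between the monoid and the comonoid structure of `H`:
weak multiplicativity of the coproduct (`mul_comul`), of the counit (`counit_mul_*`) and of the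
unit (`unit_comul_*`). -/
structure IsWeakBimonoid : Prop where
  /-- `δ ∘ μ = (μ ⊗ μ) ∘ δ_{H ⊗ H}`. -/
  mul_comul : μ[H] ≫ Δ[H] = (Δ[H] ⊗ₘ Δ[H]) ≫ tensorμ H H H H ≫ (μ[H] ⊗ₘ μ[H])
  /-- `ε ∘ μ ∘ (μ ⊗ H) = ε ∘ μ ∘ (H ⊗ μ)`. -/
  counit_mul_assoc : μ[H] ▷ H ≫ μ[H] ≫ ε[H] = (α_ H H H).hom ≫ H ◁ μ[H] ≫ μ[H] ≫ ε[H]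
  /-- `ε ∘ μ ∘ (μ ⊗ H) = ((ε ∘ μ) ⊗ (ε ∘ μ)) ∘ (H ⊗ δ ⊗ H)`. -/
  counit_mul_comul : μ[H] ▷ H ≫ μ[H] ≫ ε[H] =
    (H ◁ Δ[H]) ▷ H ≫ (α_ H H H).inv ▷ H ≫ (α_ (H ⊗ H) H H).hom ≫
      ((μ[H] ≫ ε[H]) ⊗ₘ (μ[H] ≫ ε[H])) ≫ (λ_ (𝟙_ C)).hom
  /-- `ε ∘ μ ∘ (μ ⊗ H) = ((ε ∘ μ) ⊗ (ε ∘ μ)) ∘ (H ⊗ (c⁻¹ ∘ δ) ⊗ H)`. -/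
  counit_mul_comul_braiding : μ[H] ▷ H ≫ μ[H] ≫ ε[H] =
    (H ◁ (Δ[H] ≫ (β_ H H).inv)) ▷ H ≫ (α_ H H H).inv ▷ H ≫ (α_ (H ⊗ H) H H).hom ≫
      ((μ[H] ≫ ε[H]) ⊗ₘ (μ[H] ≫ ε[H])) ≫ (λ_ (𝟙_ C)).hom
  /-- `(δ ⊗ H) ∘ δ ∘ η = (H ⊗ μ ⊗ H) ∘ ((δ ∘ η) ⊗ (δ ∘ η))`. -/
  unit_comul_mul : η[H] ≫ Δ[H] ≫ Δ[H] ▷ H =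
    (λ_ (𝟙_ C)).inv ≫ ((η[H] ≫ Δ[H]) ⊗ₘ (η[H] ≫ Δ[H])) ≫
      (α_ (H ⊗ H) H H).inv ≫ (α_ H H H).hom ▷ H ≫ (H ◁ μ[H]) ▷ H
  /-- `(δ ⊗ H) ∘ δ ∘ η = (H ⊗ (μ ∘ c⁻¹) ⊗ H) ∘ ((δ ∘ η) ⊗ (δ ∘ η))`. -/
  unit_comul_mul_braiding : η[H] ≫ Δ[H] ≫ Δ[H] ▷ H =
    (λ_ (𝟙_ C)).inv ≫ ((η[H] ≫ Δ[H]) ⊗ₘ (η[H] ≫ Δ[H])) ≫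
      (α_ (H ⊗ H) H H).inv ≫ (α_ H H H).hom ▷ H ≫ (H ◁ ((β_ H H).inv ≫ μ[H])) ▷ H

/-- The conditions on an antipode `S` of a weak Hopf quasigroup. -/
structure IsAntipode {H : C} [MonObj H] [ComonObj H] (S : H ⟶ H) : Prop where
  /-- `id ∗ S = Π^L`. -/
  id_conv : piL H = convolution (𝟙 H) S
  /-- `S ∗ id = Π^R`. -/
  conv_id : piR H = convolution S (𝟙 H)
  /-- `S ∗ Π^L = S`. -/
  conv_piL : convolution S (piL H) = S
  /-- `Π^R ∗ S = S`. -/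
  piR_conv : convolution (piR H) S = S
  /-- `μ ∘ (S ⊗ μ) ∘ (δ ⊗ H) = μ ∘ (Π^R ⊗ H)`. -/
  left_piR : Δ[H] ▷ H ≫ (α_ H H H).hom ≫ (S ⊗ₘ μ[H]) ≫ μ[H] = piR H ▷ H ≫ μ[H]
  /-- `μ ∘ (H ⊗ μ) ∘ (H ⊗ S ⊗ H) ∘ (δ ⊗ H) = μ ∘ (Π^L ⊗ H)`. -/
  left_piL : Δ[H] ▷ H ≫ (H ◁ S) ▷ H ≫ (α_ H H H).hom ≫ H ◁ μ[H] ≫ μ[H] = piL H ▷ H ≫ μ[H]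
  /-- `μ ∘ (μ ⊗ S) ∘ (H ⊗ δ) = μ ∘ (H ⊗ Π^L)`. -/
  right_piL : H ◁ Δ[H] ≫ (α_ H H H).inv ≫ (μ[H] ⊗ₘ S) ≫ μ[H] = H ◁ piL H ≫ μ[H]
  /-- `μ ∘ (μ ⊗ H) ∘ (H ⊗ S ⊗ H) ∘ (H ⊗ δ) = μ ∘ (H ⊗ Π^R)`. -/
  right_piR : H ◁ Δ[H] ≫ H ◁ (S ▷ H) ≫ (α_ H H H).inv ≫ μ[H] ▷ H ≫ μ[H] = H ◁ piR H ≫ μ[H]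

/-- `H` is a weak Hopf algebra in `C`, that is, a weak Hopf quasigroup whose product is
associative. (Associativity and the unit and comonoid laws are part of `MonObj` and `ComonObj`.) -/
structure IsWeakHopfAlgebra : Prop where
  isWeakBimonoid : IsWeakBimonoid H
  exists_antipode : ∃ S : H ⟶ H, IsAntipode S

/-- `Ω_L^1`. -/
abbrev omegaL1 : H ⊗ H ⟶ H ⊗ H := omegaOne (piL H)

/-- `Ω_R^1`. -/
abbrev omegaR1 : H ⊗ H ⟶ H ⊗ H := omegaOne (piR H)

/-- `Ω_L^2`. -/
abbrev omegaL2 : H ⊗ H ⟶ H ⊗ H := omegaTwo (piL H)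

/-- `Ω_R^2`. -/
abbrev omegaR2 : H ⊗ H ⟶ H ⊗ H := omegaTwo (piR H)

variable {H}

/-- `f = q_R^1 ∘ β ∘ j_L^1`, where `β` is the right Galois morphism. -/
def galoisF (sL : Splitting (omegaL1 H)) (sR : Splitting (omegaR1 H)) : sL.obj ⟶ sR.obj :=
  sL.j ≫ galoisRight H ≫ sR.q

/-- `g = q_L^2 ∘ γ ∘ j_R^2`, where `γ` is the left Galois morphism. -/
def galoisG (sR : Splitting (omegaR2 H)) (sL : Splitting (omegaL2 H)) : sR.obj ⟶ sL.obj :=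
  sR.j ≫ galoisLeft H ≫ sL.q

end WeakHopf

namespace WeakHopf

/-! ### Split idempotents and relative inverses. -/

section Splitting

variable {C : Type u} [Category.{v} C] {Y Z : C}

/-! For an endomorphism `P` of `H`, `omegaOne P` is `x ⊗ y ↦ x P(y₁) ⊗ y₂`. This embeds the
convolution monoid of endomorphisms of `H` into the endomorphisms of `H ⊗ H`, and the image consists
of the maps that are left linear and right colinear (`omegaOne_symbolOne`). The embedding sends `𝟙
H` to `β` and `Π^σ` to `Ω_σ^1`. So everything reduces to the convolution monoid, where `Π^L` and
`Π^R` are idempotent, `Π^L ∗ id = id` and `id ∗ Π^R = id`.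

By the last two identities `β` is compatible with the idempotents, and `f` is invertible iff `β` has
an inverse relative to them. A relative inverse commutes with whatever intertwines the original data
(`IsRelativeInverse.comm`), so it is again linear and colinear, hence equal to `omegaOne S`. Reading
the relations back gives `id ∗ S = Π^L`, `S ∗ id = Π^R`, `Π^R ∗ S = S = S ∗ Π^L`; with an
associative product these say that `S` is an antipode. The case of `g` is the mirror image, with
`omegaTwo` reversing the order of convolution in diagrammatic composition.

The identities for `Π^L` and `Π^R` come from `Δ(1)Δ(x) = Δ(x) = Δ(x)Δ(1)` and the weak unit axiom
with the inverse braiding. The main step is `x₁ ⊗ Π^L(x₂) = 1₁x ⊗ 1₂`, with its mirror image for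
`Π^R`. -/

theorem Splitting.e_q {e : Y ⟶ Y} (s : Splitting e) : e ≫ s.q = s.q := by
  obtain ⟨X, q, j, rfl, h⟩ := s
  simp [h]

theorem Splitting.j_e {e : Y ⟶ Y} (s : Splitting e) : s.j ≫ e = s.j := by
  obtain ⟨X, q, j, rfl, h⟩ := s
  simp [reassoc_of% h]

theorem nonempty_splitting [Limits.HasEqualizers C] {e : Y ⟶ Y} (he : e ≫ e = e) :
    Nonempty (Splitting e) := by
  have hC : IsIdempotentComplete C :=
    (Idempotents.isIdempotentComplete_iff_hasEqualizer_of_id_and_idempotent C).mpr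
      fun _ _ _ => inferInstance
  obtain ⟨Z, i, r, h₁, h₂⟩ := hC.idempotents_split Y e he
  exact ⟨⟨Z, r, i, h₂, h₁⟩⟩

/-- `b'` inverts `b` relative to the idempotents `e` and `e'`. -/
structure IsRelativeInverse (e e' b b' : Y ⟶ Y) : Prop where
  comp_left : b ≫ b' = e
  comp_right : b' ≫ b = e'
  left_id : e' ≫ b' = b'
  right_id : b' ≫ e = b'

/-- A morphism compatible with two split idempotents induces an isomorphism between their images
if and only if it is invertible relative to the idempotents. -/
theorem isIso_splitting_iff {e e' b : Y ⟶ Y} (s : Splitting e) (s' : Splitting e')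
    (heb : e ≫ b = b) (hbe : b ≫ e' = b) :
    IsIso (s.j ≫ b ≫ s'.q) ↔ ∃ b' : Y ⟶ Y, IsRelativeInverse e e' b b' := by
  constructor
  · intro h
    have h₁ : b ≫ s'.q = s.q ≫ s.j ≫ b ≫ s'.q := by
      rw [← Category.assoc s.q, s.q_j, ← Category.assoc, heb]
    have h₂ : s.j ≫ b = (s.j ≫ b ≫ s'.q) ≫ s'.j := by
      simp only [Category.assoc, s'.q_j, hbe]
    -- The inverse between the images, transported to `Y` by projecting first and including
    -- afterwards.
    refine ⟨s'.q ≫ inv (s.j ≫ b ≫ s'.q) ≫ s.j, ?_, ?_, ?_, ?_⟩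
    · rw [← Category.assoc]
      refine (congrArg (· ≫ _) h₁).trans ?_
      rw [Category.assoc, IsIso.hom_inv_id_assoc, s.q_j]
    · rw [Category.assoc, Category.assoc, h₂, IsIso.inv_hom_id_assoc, s'.q_j]
    · rw [← Category.assoc, s'.e_q]
    · simp only [Category.assoc, s.j_e]
  · rintro ⟨b', h⟩
    refine ⟨s'.j ≫ b' ≫ s.q, ?_, ?_⟩
    · calc (s.j ≫ b ≫ s'.q) ≫ s'.j ≫ b' ≫ s.q
          = s.j ≫ (b ≫ (s'.q ≫ s'.j)) ≫ b' ≫ s.q := by simp only [Category.assoc]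
        _ = (s.j ≫ e) ≫ s.q := by
            rw [s'.q_j, hbe, ← Category.assoc b, h.comp_left, Category.assoc]
        _ = 𝟙 _ := by rw [s.j_e, s.j_q]
    · calc (s'.j ≫ b' ≫ s.q) ≫ s.j ≫ b ≫ s'.q
          = s'.j ≫ b' ≫ ((s.q ≫ s.j) ≫ b) ≫ s'.q := by simp only [Category.assoc]
        _ = (s'.j ≫ e') ≫ s'.q := by
            rw [s.q_j, heb, ← Category.assoc b', h.comp_right, Category.assoc]
        _ = 𝟙 _ := by rw [s'.j_e, s'.j_q]

/-- A morphism that intertwines `b` with `g`, together with their idempotents, intertwines their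
relative inverses. -/
theorem IsRelativeInverse.comm {e e' b b' : Y ⟶ Y} {f f' g g' : Z ⟶ Z}
    (hb : IsRelativeInverse e e' b b') (hg : IsRelativeInverse f f' g g') (t : Y ⟶ Z)
    (ht : b ≫ t = t ≫ g) (he : e ≫ t = t ≫ f) (he' : e' ≫ t = t ≫ f') :
    b' ≫ t = t ≫ g' :=
  calc b' ≫ t = b' ≫ e ≫ t := by rw [← Category.assoc, hb.right_id]
    _ = b' ≫ (t ≫ g) ≫ g' := by rw [he, ← hg.comp_left, Category.assoc]
    _ = (b' ≫ b) ≫ t ≫ g' := by simp only [← ht, Category.assoc]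
    _ = (t ≫ f') ≫ g' := by rw [hb.comp_right, ← Category.assoc, he']
    _ = t ≫ g' := by rw [Category.assoc, hg.left_id]

theorem IsRelativeInverse.conj {e e' b b' : Y ⟶ Y} (h : IsRelativeInverse e e' b b')
    (i : Z ≅ Y) :
    IsRelativeInverse (i.hom ≫ e ≫ i.inv) (i.hom ≫ e' ≫ i.inv) (i.hom ≫ b ≫ i.inv)
      (i.hom ≫ b' ≫ i.inv) where
  comp_left := by simp [← h.comp_left]
  comp_right := by simp [← h.comp_right]
  left_id := by simp [reassoc_of% h.left_id]
  right_id := by simp [reassoc_of% h.right_id]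

theorem IsRelativeInverse.whiskerLeft [MonoidalCategory C] {e e' b b' : Y ⟶ Y}
    (h : IsRelativeInverse e e' b b') (X : C) :
    IsRelativeInverse (X ◁ e) (X ◁ e') (X ◁ b) (X ◁ b') where
  comp_left := by rw [← MonoidalCategory.whiskerLeft_comp, h.comp_left]
  comp_right := by rw [← MonoidalCategory.whiskerLeft_comp, h.comp_right]
  left_id := by rw [← MonoidalCategory.whiskerLeft_comp, h.left_id]
  right_id := by rw [← MonoidalCategory.whiskerLeft_comp, h.right_id]

theorem IsRelativeInverse.whiskerRight [MonoidalCategory C] {e e' b b' : Y ⟶ Y}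
    (h : IsRelativeInverse e e' b b') (X : C) :
    IsRelativeInverse (e ▷ X) (e' ▷ X) (b ▷ X) (b' ▷ X) where
  comp_left := by rw [← MonoidalCategory.comp_whiskerRight, h.comp_left]
  comp_right := by rw [← MonoidalCategory.comp_whiskerRight, h.comp_right]
  left_id := by rw [← MonoidalCategory.comp_whiskerRight, h.left_id]
  right_id := by rw [← MonoidalCategory.comp_whiskerRight, h.right_id]

end Splitting

/-! ### The convolution monoid inside the endomorphisms of `H ⊗ H`. -/

section Convolution

variable {C : Type u} [Category.{v} C] [MonoidalCategory C] {H : C} [MonObj H] [ComonObj H]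

theorem omegaOne_id : omegaOne (𝟙 H) = galoisRight H := by
  simp [omegaOne, galoisRight]

theorem omegaTwo_id : omegaTwo (𝟙 H) = galoisLeft H := by
  simp [omegaTwo, galoisLeft]

/-- Both sides are `x ⊗ y ↦ x P(y₁) Q(y₂) ⊗ y₃`, by associativity and coassociativity. -/
theorem omegaOne_comp (P Q : H ⟶ H) :
    omegaOne P ≫ omegaOne Q = omegaOne (convolution P Q) := by
  simp only [omegaOne, convolution, MonoidalCategory.tensorHom_def]
  calc _ = H ◁ (Δ[H] ≫ P ▷ H) ⊗≫ (μ[H] ▷ H ≫ H ◁ Δ[H]) ⊗≫ H ◁ Q ▷ H ⊗≫ μ[H] ▷ H := by monoidal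
    _ = H ◁ Δ[H] ⊗≫ H ◁ (P ▷ H ≫ H ◁ Δ[H]) ⊗≫ (μ[H] ▷ H ≫ H ◁ Q) ▷ H ⊗≫ μ[H] ▷ H := by
      rw [← whisker_exchange]; monoidal
    _ = H ◁ (Δ[H] ≫ H ◁ Δ[H]) ⊗≫ H ◁ (P ▷ H ≫ H ◁ Q) ▷ H ⊗≫ (μ[H] ▷ H ≫ μ[H]) ▷ H := by
      rw [← whisker_exchange, ← whisker_exchange]; monoidal
    _ = _ := by
      rw [comul_assoc, MonObj.mul_assoc]; monoidal

/-- The factor applied last multiplies from the left, which reverses the order compared with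
`omegaOne`. -/
theorem omegaTwo_comp (P Q : H ⟶ H) :
    omegaTwo Q ≫ omegaTwo P = omegaTwo (convolution P Q) := by
  simp only [omegaTwo, convolution, MonoidalCategory.tensorHom_def]
  calc _ = (Δ[H] ≫ H ◁ Q) ▷ H ⊗≫ (H ◁ μ[H] ≫ Δ[H] ▷ H) ⊗≫ H ◁ P ▷ H ⊗≫ H ◁ μ[H] := by monoidal
    _ = Δ[H] ▷ H ⊗≫ (H ◁ Q ≫ Δ[H] ▷ H) ▷ H ⊗≫ H ◁ (H ◁ μ[H] ≫ P ▷ H) ⊗≫ H ◁ μ[H] := by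
      rw [whisker_exchange]; monoidal
    _ = (Δ[H] ≫ Δ[H] ▷ H) ▷ H ⊗≫ H ◁ (H ◁ Q ≫ P ▷ H) ▷ H ⊗≫ H ◁ (H ◁ μ[H] ≫ μ[H]) := by
      rw [whisker_exchange, whisker_exchange]; monoidal
    _ = _ := by
      rw [comul_assoc_flip, mul_assoc_flip, whisker_exchange]; monoidal

/-- The endomorphism `P` for which `F = omegaOne P`, if there is one. -/
def symbolOne (F : H ⊗ H ⟶ H ⊗ H) : H ⟶ H :=
  (λ_ H).inv ≫ η[H] ▷ H ≫ F ≫ H ◁ ε[H] ≫ (ρ_ H).hom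

/-- The endomorphism `P` for which `F = omegaTwo P`, if there is one. -/
def symbolTwo (F : H ⊗ H ⟶ H ⊗ H) : H ⟶ H :=
  (ρ_ H).inv ≫ H ◁ η[H] ≫ F ≫ ε[H] ▷ H ≫ (λ_ H).hom

theorem symbolOne_omegaOne (P : H ⟶ H) : symbolOne (omegaOne P) = P := by
  simp only [symbolOne, omegaOne]
  calc _ = (λ_ H).inv ≫ η[H] ▷ H ≫ H ◁ (Δ[H] ≫ P ▷ H) ⊗≫ (μ[H] ▷ H ≫ H ◁ ε[H]) ⊗≫ 𝟙 _ := by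
        monoidal
    _ = (λ_ H).inv ≫ η[H] ▷ H ≫ H ◁ (Δ[H] ≫ (P ▷ H ≫ H ◁ ε[H])) ⊗≫ μ[H] ⊗≫ 𝟙 _ := by
      rw [← whisker_exchange]; monoidal
    _ = (λ_ H).inv ≫ η[H] ▷ H ≫ H ◁ ((Δ[H] ≫ H ◁ ε[H]) ≫ (P ▷ 𝟙_ C)) ⊗≫ μ[H] ⊗≫ 𝟙 _ := by
      rw [← whisker_exchange P, Category.assoc]
    _ = (λ_ H).inv ≫ (η[H] ▷ H ≫ H ◁ P) ⊗≫ μ[H] ⊗≫ 𝟙 _ := by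
      rw [comul_counit]; monoidal
    _ = P ⊗≫ (η[H] ▷ H ≫ μ[H]) ⊗≫ 𝟙 _ := by
      rw [← whisker_exchange]; monoidal
    _ = P := by rw [MonObj.one_mul]; monoidal

theorem symbolTwo_omegaTwo (P : H ⟶ H) : symbolTwo (omegaTwo P) = P := by
  simp only [symbolTwo, omegaTwo]
  calc _ = (ρ_ H).inv ≫ H ◁ η[H] ≫ (Δ[H] ≫ H ◁ P) ▷ H ⊗≫ (H ◁ μ[H] ≫ ε[H] ▷ H) ⊗≫ 𝟙 _ := by
        monoidal
    _ = (ρ_ H).inv ≫ H ◁ η[H] ≫ (Δ[H] ≫ (H ◁ P ≫ ε[H] ▷ H)) ▷ H ⊗≫ μ[H] ⊗≫ 𝟙 _ := by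
      rw [whisker_exchange ε[H]]; monoidal
    _ = (ρ_ H).inv ≫ H ◁ η[H] ≫ ((Δ[H] ≫ ε[H] ▷ H) ≫ (𝟙_ C ◁ P)) ▷ H ⊗≫ μ[H] ⊗≫ 𝟙 _ := by
      rw [whisker_exchange ε[H] P, Category.assoc]
    _ = (ρ_ H).inv ≫ (H ◁ η[H] ≫ P ▷ H) ⊗≫ μ[H] ⊗≫ 𝟙 _ := by
      rw [counit_comul]; monoidal
    _ = P ⊗≫ (H ◁ η[H] ≫ μ[H]) ⊗≫ 𝟙 _ := by
      rw [whisker_exchange]; monoidal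
    _ = P := by rw [MonObj.mul_one]; monoidal

theorem omegaOne_injective : Function.Injective (omegaOne (H := H)) :=
  Function.LeftInverse.injective symbolOne_omegaOne

theorem omegaTwo_injective : Function.Injective (omegaTwo (H := H)) :=
  Function.LeftInverse.injective symbolTwo_omegaTwo

theorem omegaOne_mul (P : H ⟶ H) :
    ((α_ H H H).hom ≫ H ◁ omegaOne P ≫ (α_ H H H).inv) ≫ μ[H] ▷ H = μ[H] ▷ H ≫ omegaOne P := by
  simp only [omegaOne]
  symm
  calc _ = (μ[H] ▷ H ≫ H ◁ (Δ[H] ≫ P ▷ H)) ⊗≫ μ[H] ▷ H := by monoidal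
    _ = 𝟙 _ ⊗≫ H ◁ H ◁ (Δ[H] ≫ P ▷ H) ⊗≫ (μ[H] ▷ H ≫ μ[H]) ▷ H := by
      rw [← whisker_exchange]; monoidal
    _ = _ := by rw [MonObj.mul_assoc]; monoidal

theorem omegaTwo_mul (P : H ⟶ H) :
    ((α_ H H H).inv ≫ omegaTwo P ▷ H ≫ (α_ H H H).hom) ≫ H ◁ μ[H] = H ◁ μ[H] ≫ omegaTwo P := by
  simp only [omegaTwo]
  symm
  calc _ = (H ◁ μ[H] ≫ (Δ[H] ≫ H ◁ P) ▷ H) ⊗≫ H ◁ μ[H] := by monoidal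
    _ = 𝟙 _ ⊗≫ (Δ[H] ≫ H ◁ P) ▷ H ▷ H ⊗≫ H ◁ (H ◁ μ[H] ≫ μ[H]) := by
      rw [whisker_exchange]; monoidal
    _ = _ := by rw [mul_assoc_flip]; monoidal

theorem omegaOne_comul (P : H ⟶ H) :
    omegaOne P ≫ H ◁ Δ[H] ≫ (α_ H H H).inv =
      (H ◁ Δ[H] ≫ (α_ H H H).inv) ≫ omegaOne P ▷ H := by
  simp only [omegaOne]
  calc _ = H ◁ (Δ[H] ≫ P ▷ H) ⊗≫ (μ[H] ▷ H ≫ H ◁ Δ[H]) ⊗≫ 𝟙 _ := by monoidal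
    _ = H ◁ (Δ[H] ≫ (P ▷ H ≫ H ◁ Δ[H])) ⊗≫ μ[H] ▷ H ▷ H := by
      rw [← whisker_exchange]; monoidal
    _ = H ◁ (Δ[H] ≫ H ◁ Δ[H]) ⊗≫ H ◁ P ▷ H ▷ H ⊗≫ μ[H] ▷ H ▷ H := by
      rw [← whisker_exchange]; monoidal
    _ = _ := by rw [comul_assoc]; monoidal

theorem omegaTwo_comul (P : H ⟶ H) :
    omegaTwo P ≫ Δ[H] ▷ H ≫ (α_ H H H).hom =
      (Δ[H] ▷ H ≫ (α_ H H H).hom) ≫ H ◁ omegaTwo P := by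
  simp only [omegaTwo]
  calc _ = (Δ[H] ≫ H ◁ P) ▷ H ⊗≫ (H ◁ μ[H] ≫ Δ[H] ▷ H) ⊗≫ 𝟙 _ := by monoidal
    _ = (Δ[H] ≫ (H ◁ P ≫ Δ[H] ▷ H)) ▷ H ⊗≫ H ◁ H ◁ μ[H] := by
      rw [whisker_exchange]; monoidal
    _ = (Δ[H] ≫ Δ[H] ▷ H) ▷ H ⊗≫ H ◁ H ◁ P ▷ H ⊗≫ H ◁ H ◁ μ[H] := by
      rw [whisker_exchange]; monoidal
    _ = _ := by rw [comul_assoc_flip]; monoidal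

/-- The morphisms `omegaOne P` are those that are linear for the regular left action on the first
factor and colinear for the regular right coaction on the second. -/
theorem omegaOne_symbolOne {F : H ⊗ H ⟶ H ⊗ H}
    (h₁ : ((α_ H H H).hom ≫ H ◁ F ≫ (α_ H H H).inv) ≫ μ[H] ▷ H = μ[H] ▷ H ≫ F)
    (h₂ : F ≫ H ◁ Δ[H] ≫ (α_ H H H).inv = (H ◁ Δ[H] ≫ (α_ H H H).inv) ≫ F ▷ H) :
    omegaOne (symbolOne F) = F := by
  simp only [omegaOne, symbolOne]
  -- Colinearity moves `Δ` past `F`, where it meets `ε`; linearity then moves `μ` before `F`, where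
  -- it meets `η`.
  calc _ = H ◁ (Δ[H] ⊗≫ η[H] ▷ H ▷ H ⊗≫ F ▷ H ⊗≫ H ◁ ε[H] ▷ H) ⊗≫ μ[H] ▷ H := by monoidal
    _ = 𝟙 _ ⊗≫ H ◁ ((𝟙_ C ◁ Δ[H] ≫ η[H] ▷ (H ⊗ H)) ⊗≫ F ▷ H ⊗≫ H ◁ ε[H] ▷ H) ⊗≫ μ[H] ▷ H := by
      monoidal
    _ = 𝟙 _ ⊗≫ H ◁ (η[H] ▷ H ≫ ((H ◁ Δ[H] ≫ (α_ H H H).inv) ≫ F ▷ H) ⊗≫ H ◁ ε[H] ▷ H) ⊗≫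
          μ[H] ▷ H := by rw [whisker_exchange]; monoidal
    _ = 𝟙 _ ⊗≫ H ◁ (η[H] ▷ H ≫ F ≫ H ◁ (Δ[H] ≫ ε[H] ▷ H)) ⊗≫ μ[H] ▷ H := by
      rw [← h₂]; monoidal
    _ = 𝟙 _ ⊗≫ H ◁ η[H] ▷ H ⊗≫ ((α_ H H H).hom ≫ H ◁ F ≫ (α_ H H H).inv) ≫ μ[H] ▷ H := by
      rw [counit_comul]; monoidal
    _ = 𝟙 _ ⊗≫ (H ◁ η[H] ≫ μ[H]) ▷ H ≫ F := by rw [h₁]; monoidal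
    _ = F := by rw [MonObj.mul_one]; monoidal

/-- The morphisms `omegaTwo P` are those that are linear for the regular right action on the second
factor and colinear for the regular left coaction on the first. -/
theorem omegaTwo_symbolTwo {F : H ⊗ H ⟶ H ⊗ H}
    (h₁ : ((α_ H H H).inv ≫ F ▷ H ≫ (α_ H H H).hom) ≫ H ◁ μ[H] = H ◁ μ[H] ≫ F)
    (h₂ : F ≫ Δ[H] ▷ H ≫ (α_ H H H).hom = (Δ[H] ▷ H ≫ (α_ H H H).hom) ≫ H ◁ F) :
    omegaTwo (symbolTwo F) = F := by
  simp only [omegaTwo, symbolTwo]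
  calc _ = 𝟙 _ ⊗≫ ((Δ[H] ▷ 𝟙_ C ≫ (H ⊗ H) ◁ η[H]) ⊗≫ H ◁ F ⊗≫ H ◁ ε[H] ▷ H) ▷ H ⊗≫
          H ◁ μ[H] := by monoidal
    _ = 𝟙 _ ⊗≫ (H ◁ η[H] ≫ ((Δ[H] ▷ H ≫ (α_ H H H).hom) ≫ H ◁ F) ⊗≫ H ◁ ε[H] ▷ H) ▷ H ⊗≫
          H ◁ μ[H] := by rw [← whisker_exchange]; monoidal
    _ = 𝟙 _ ⊗≫ (H ◁ η[H] ≫ F ≫ (Δ[H] ≫ H ◁ ε[H]) ▷ H) ▷ H ⊗≫ H ◁ μ[H] := by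
      rw [← h₂]; monoidal
    _ = 𝟙 _ ⊗≫ H ◁ η[H] ▷ H ⊗≫ ((α_ H H H).inv ≫ F ▷ H ≫ (α_ H H H).hom) ≫ H ◁ μ[H] := by
      rw [comul_counit]; monoidal
    _ = 𝟙 _ ⊗≫ H ◁ (η[H] ▷ H ≫ μ[H]) ≫ F := by rw [h₁]; monoidal
    _ = F := by rw [MonObj.one_mul]; monoidal

theorem exists_isRelativeInverse_omegaOne_iff {L R : H ⟶ H} :
    (∃ b, IsRelativeInverse (omegaOne L) (omegaOne R) (omegaOne (𝟙 H)) b) ↔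
      ∃ S : H ⟶ H, convolution (𝟙 H) S = L ∧ convolution S (𝟙 H) = R ∧
        convolution R S = S ∧ convolution S L = S := by
  constructor
  · rintro ⟨b, h⟩
    have hb : omegaOne (symbolOne b) = b := by
      apply omegaOne_symbolOne
      -- Linearity of `b` is the case where the intertwiner is the action; colinearity is the case
      -- where it is the coaction.
      · exact ((h.whiskerLeft H).conj (α_ H H H)).comm h (μ[H] ▷ H) (omegaOne_mul _)
          (omegaOne_mul _) (omegaOne_mul _)
      · exact h.comm (h.whiskerRight H) (H ◁ Δ[H] ≫ (α_ H H H).inv) (omegaOne_comul _)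
          (omegaOne_comul _) (omegaOne_comul _)
    refine ⟨symbolOne b, ?_, ?_, ?_, ?_⟩ <;> apply omegaOne_injective <;>
      rw [← omegaOne_comp, hb]
    exacts [h.comp_left, h.comp_right, h.left_id, h.right_id]
  · rintro ⟨S, h₁, h₂, h₃, h₄⟩
    refine ⟨omegaOne S, ?_, ?_, ?_, ?_⟩ <;> rw [omegaOne_comp]
    exacts [congrArg _ h₁, congrArg _ h₂, congrArg _ h₃, congrArg _ h₄]

theorem exists_isRelativeInverse_omegaTwo_iff {L R : H ⟶ H} :
    (∃ b, IsRelativeInverse (omegaTwo R) (omegaTwo L) (omegaTwo (𝟙 H)) b) ↔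
      ∃ S : H ⟶ H, convolution (𝟙 H) S = L ∧ convolution S (𝟙 H) = R ∧
        convolution R S = S ∧ convolution S L = S := by
  constructor
  · rintro ⟨b, h⟩
    have hb : omegaTwo (symbolTwo b) = b := by
      apply omegaTwo_symbolTwo
      · exact ((h.whiskerRight H).conj (α_ H H H).symm).comm h (H ◁ μ[H]) (omegaTwo_mul _)
          (omegaTwo_mul _) (omegaTwo_mul _)
      · exact h.comm (h.whiskerLeft H) (Δ[H] ▷ H ≫ (α_ H H H).hom) (omegaTwo_comul _)
          (omegaTwo_comul _) (omegaTwo_comul _)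
    refine ⟨symbolTwo b, ?_, ?_, ?_, ?_⟩ <;> apply omegaTwo_injective <;>
      rw [← omegaTwo_comp, hb]
    exacts [h.comp_right, h.comp_left, h.right_id, h.left_id]
  · rintro ⟨S, h₁, h₂, h₃, h₄⟩
    refine ⟨omegaTwo S, ?_, ?_, ?_, ?_⟩ <;> rw [omegaTwo_comp]
    exacts [congrArg _ h₂, congrArg _ h₁, congrArg _ h₄, congrArg _ h₃]

end Convolution

/-! ### Antipodes as relative convolution inverses of the identity. -/

section Antipode

variable {C : Type u} [Category.{v} C] [MonoidalCategory C] [BraidedCategory C]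
  {H : C} [MonObj H] [ComonObj H]

/-- The last four antipode axioms are the first two multiplied by a further element and
reassociated. -/
theorem IsAntipode.of_convolution {S : H ⟶ H} (h₁ : convolution (𝟙 H) S = piL H)
    (h₂ : convolution S (𝟙 H) = piR H) (h₃ : convolution (piR H) S = S)
    (h₄ : convolution S (piL H) = S) : IsAntipode S where
  id_conv := h₁.symm
  conv_id := h₂.symm
  conv_piL := h₄
  piR_conv := h₃
  left_piR := by
    simp only [← h₂, convolution, MonoidalCategory.tensorHom_def]
    calc _ = 𝟙 _ ⊗≫ (Δ[H] ≫ S ▷ H) ▷ H ⊗≫ H ◁ μ[H] ≫ μ[H] := by monoidal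
      _ = _ := by rw [mul_assoc_flip]; monoidal
  left_piL := by
    simp only [← h₁, convolution, MonoidalCategory.tensorHom_def]
    calc _ = 𝟙 _ ⊗≫ (Δ[H] ≫ H ◁ S) ▷ H ⊗≫ H ◁ μ[H] ≫ μ[H] := by monoidal
      _ = _ := by rw [mul_assoc_flip]; monoidal
  right_piL := by
    simp only [← h₁, convolution, MonoidalCategory.tensorHom_def']
    calc _ = 𝟙 _ ⊗≫ H ◁ (Δ[H] ≫ H ◁ S) ⊗≫ μ[H] ▷ H ≫ μ[H] := by monoidal
      _ = _ := by rw [MonObj.mul_assoc]; monoidal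
  right_piR := by
    simp only [← h₂, convolution, MonoidalCategory.tensorHom_def]
    calc _ = 𝟙 _ ⊗≫ H ◁ (Δ[H] ≫ S ▷ H) ⊗≫ μ[H] ▷ H ≫ μ[H] := by monoidal
      _ = _ := by rw [MonObj.mul_assoc]; monoidal

theorem exists_isAntipode_iff :
    (∃ S : H ⟶ H, IsAntipode S) ↔
      ∃ S : H ⟶ H, convolution (𝟙 H) S = piL H ∧ convolution S (𝟙 H) = piR H ∧
        convolution (piR H) S = S ∧ convolution S (piL H) = S :=
  ⟨fun ⟨S, h⟩ => ⟨S, h.id_conv.symm, h.conv_id.symm, h.piR_conv, h.conv_piL⟩,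
    fun ⟨S, h₁, h₂, h₃, h₄⟩ => ⟨S, .of_convolution h₁ h₂ h₃ h₄⟩⟩

end Antipode

/-! ### Convolution identities for `Π^L` and `Π^R`. -/

section Projections

variable {C : Type u} [Category.{v} C] [MonoidalCategory C] [BraidedCategory C]

/-- By naturality, a strand crosses the whole of `w` trivially, so crossing one leg amounts to
undoing the crossing with the other. This produces the inverse braiding of the weak unit axiom. -/
theorem insert_comp_braiding {X Y Z : C} (w : 𝟙_ C ⟶ X ⊗ Y) :
    (λ_ Z).inv ≫ w ▷ Z ≫ (α_ X Y Z).hom ≫ X ◁ (β_ Y Z).hom =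
      (ρ_ Z).inv ≫ Z ◁ w ≫ (α_ Z X Y).inv ≫ (β_ X Z).inv ▷ Y ≫ (α_ X Z Y).hom := by
  have h := BraidedCategory.braiding_naturality_left w Z
  rw [BraidedCategory.braiding_tensor_left_hom, braiding_tensorUnit_left] at h
  rw [← cancel_mono (α_ X Z Y).inv, ← cancel_mono ((β_ X Z).hom ▷ Y),
    ← cancel_mono (α_ Z X Y).hom]
  simp only [Category.assoc] at h ⊢
  rw [h]
  simp

theorem insert_comp_braiding' {X Y Z : C} (w : 𝟙_ C ⟶ X ⊗ Y) :
    (ρ_ Z).inv ≫ Z ◁ w ≫ (α_ Z X Y).inv ≫ (β_ Z X).hom ▷ Y =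
      (λ_ Z).inv ≫ w ▷ Z ≫ (α_ X Y Z).hom ≫ X ◁ (β_ Z Y).inv ≫ (α_ X Z Y).inv := by
  have h := BraidedCategory.braiding_naturality_right Z w
  rw [BraidedCategory.braiding_tensor_right_hom, braiding_tensorUnit_right] at h
  rw [← cancel_mono (α_ X Z Y).hom, ← cancel_mono (X ◁ (β_ Z Y).hom),
    ← cancel_mono (α_ X Y Z).inv]
  simp only [Category.assoc] at h ⊢
  rw [h]
  simp

variable (H : C) [MonObj H]

/-- The right action of `H` on the first factor of `H ⊗ H`. -/
def actFirst : (H ⊗ H) ⊗ H ⟶ H ⊗ H :=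
  (α_ H H H).hom ≫ H ◁ (β_ H H).hom ≫ (α_ H H H).inv ≫ μ[H] ▷ H

/-- The left action of `H` on the second factor of `H ⊗ H`. -/
def actSecond : H ⊗ (H ⊗ H) ⟶ H ⊗ H :=
  (α_ H H H).inv ≫ (β_ H H).hom ▷ H ≫ (α_ H H H).hom ≫ H ◁ μ[H]

theorem actFirst_assoc :
    actFirst H ▷ H ≫ actFirst H = (α_ (H ⊗ H) H H).hom ≫ (H ⊗ H) ◁ μ[H] ≫ actFirst H := by
  simp only [actFirst]
  calc _ = 𝟙 _ ⊗≫ H ◁ (β_ H H).hom ▷ H ⊗≫ (μ[H] ▷ (H ⊗ H) ≫ H ◁ (β_ H H).hom) ⊗≫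
          μ[H] ▷ H := by monoidal
    _ = 𝟙 _ ⊗≫ H ◁ (β_ H H).hom ▷ H ⊗≫ H ◁ H ◁ (β_ H H).hom ⊗≫ (μ[H] ▷ H ≫ μ[H]) ▷ H := by
      rw [← whisker_exchange]; monoidal
    _ = 𝟙 _ ⊗≫ H ◁ ((β_ H (H ⊗ H)).hom ≫ μ[H] ▷ H) ⊗≫ μ[H] ▷ H := by
      rw [MonObj.mul_assoc, BraidedCategory.braiding_tensor_right_hom]; monoidal
    _ = _ := by rw [← BraidedCategory.braiding_naturality_right]; monoidal

theorem actSecond_assoc :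
    H ◁ actSecond H ≫ actSecond H = (α_ H H (H ⊗ H)).inv ≫ μ[H] ▷ (H ⊗ H) ≫ actSecond H := by
  simp only [actSecond]
  calc _ = 𝟙 _ ⊗≫ H ◁ (β_ H H).hom ▷ H ⊗≫ ((H ⊗ H) ◁ μ[H] ≫ (β_ H H).hom ▷ H) ⊗≫
          H ◁ μ[H] := by monoidal
    _ = 𝟙 _ ⊗≫ H ◁ (β_ H H).hom ▷ H ⊗≫ (β_ H H).hom ▷ H ▷ H ⊗≫ H ◁ (H ◁ μ[H] ≫ μ[H]) := by
      rw [whisker_exchange]; monoidal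
    _ = 𝟙 _ ⊗≫ ((β_ (H ⊗ H) H).hom ≫ H ◁ μ[H]) ▷ H ⊗≫ H ◁ μ[H] := by
      rw [mul_assoc_flip, BraidedCategory.braiding_tensor_left_hom]; monoidal
    _ = _ := by rw [← BraidedCategory.braiding_naturality_left]; monoidal

variable [ComonObj H]

/-- The action of `H` on the first factor of `δ ∘ η`. -/
def splitL : H ⟶ H ⊗ H :=
  (λ_ H).inv ≫ (η[H] ≫ Δ[H]) ▷ H ≫ actFirst H

/-- The action of `H` on the second factor of `δ ∘ η`. -/
def splitR : H ⟶ H ⊗ H :=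
  (ρ_ H).inv ≫ H ◁ (η[H] ≫ Δ[H]) ≫ actSecond H

theorem splitL_counit : splitL H ≫ ε[H] ▷ H ≫ (λ_ H).hom = piL H := by
  simp [splitL, actFirst, piL]

theorem splitR_counit : splitR H ≫ H ◁ ε[H] ≫ (ρ_ H).hom = piR H := by
  simp [splitR, actSecond, piR]

theorem mul_splitL : μ[H] ≫ splitL H = splitL H ▷ H ≫ actFirst H := by
  simp only [splitL]
  calc _ = 𝟙 _ ⊗≫ (𝟙_ C ◁ μ[H] ≫ (η[H] ≫ Δ[H]) ▷ H) ≫ actFirst H := by monoidal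
    _ = 𝟙 _ ⊗≫ (η[H] ≫ Δ[H]) ▷ H ▷ H ⊗≫ (α_ (H ⊗ H) H H).hom ≫ (H ⊗ H) ◁ μ[H] ≫ actFirst H := by
      rw [whisker_exchange]; monoidal
    _ = _ := by rw [← actFirst_assoc]; monoidal

theorem mul_splitR : μ[H] ≫ splitR H = H ◁ splitR H ≫ actSecond H := by
  simp only [splitR]
  calc _ = 𝟙 _ ⊗≫ (μ[H] ▷ 𝟙_ C ≫ H ◁ (η[H] ≫ Δ[H])) ≫ actSecond H := by monoidal
    _ = 𝟙 _ ⊗≫ H ◁ H ◁ (η[H] ≫ Δ[H]) ⊗≫ (α_ H H (H ⊗ H)).inv ≫ μ[H] ▷ (H ⊗ H) ≫ actSecond H := by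
      rw [← whisker_exchange]; monoidal
    _ = _ := by rw [← actSecond_assoc]; monoidal

variable {H}

/-- This is `Δ(1)Δ(x) = Δ(1x)`. -/
theorem comul_splitL_mul (hH : IsWeakBimonoid H) :
    Δ[H] ≫ splitL H ▷ H ≫ (α_ H H H).hom ≫ H ◁ μ[H] = Δ[H] := by
  calc _ = 𝟙 _ ⊗≫ (𝟙_ C ◁ Δ[H] ≫ (η[H] ≫ Δ[H]) ▷ (H ⊗ H)) ⊗≫ H ◁ (β_ H H).hom ▷ H ⊗≫
          μ[H] ▷ H ▷ H ⊗≫ H ◁ μ[H] := by simp only [splitL, actFirst]; monoidal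
    _ = 𝟙 _ ⊗≫ η[H] ▷ H ≫ (Δ[H] ⊗ₘ Δ[H]) ≫ tensorμ H H H H ≫ (μ[H] ⊗ₘ μ[H]) := by
      rw [whisker_exchange]
      simp only [tensorμ, MonoidalCategory.tensorHom_def]; monoidal
    _ = 𝟙 _ ⊗≫ (η[H] ▷ H ≫ μ[H]) ≫ Δ[H] := by
      rw [← hH.mul_comul]; monoidal
    _ = _ := by rw [MonObj.one_mul]; monoidal

theorem comul_splitR_mul (hH : IsWeakBimonoid H) :
    Δ[H] ≫ H ◁ splitR H ≫ (α_ H H H).inv ≫ μ[H] ▷ H = Δ[H] := by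
  calc _ = 𝟙 _ ⊗≫ (Δ[H] ▷ 𝟙_ C ≫ (H ⊗ H) ◁ (η[H] ≫ Δ[H])) ⊗≫ H ◁ (β_ H H).hom ▷ H ⊗≫
          (H ⊗ H) ◁ μ[H] ⊗≫ μ[H] ▷ H := by simp only [splitR, actSecond]; monoidal
    _ = 𝟙 _ ⊗≫ H ◁ η[H] ≫ (Δ[H] ⊗ₘ Δ[H]) ≫ tensorμ H H H H ≫ (μ[H] ⊗ₘ μ[H]) := by
      rw [← whisker_exchange]
      simp only [tensorμ, MonoidalCategory.tensorHom_def']; monoidal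
    _ = 𝟙 _ ⊗≫ (H ◁ η[H] ≫ μ[H]) ≫ Δ[H] := by
      rw [← hH.mul_comul]; monoidal
    _ = _ := by rw [MonObj.mul_one]; monoidal

/-- Apply `ε` to the first factor of `Δ(1)Δ(x) = Δ(x)`. -/
theorem piL_convolution_id (hH : IsWeakBimonoid H) : convolution (piL H) (𝟙 H) = 𝟙 H := by
  simp only [convolution, tensorHom_id, ← splitL_counit]
  calc _ = Δ[H] ≫ splitL H ▷ H ⊗≫ (ε[H] ▷ (H ⊗ H) ≫ 𝟙_ C ◁ μ[H]) ⊗≫ 𝟙 _ := by monoidal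
    _ = (Δ[H] ≫ splitL H ▷ H ≫ (α_ H H H).hom ≫ H ◁ μ[H]) ≫ ε[H] ▷ H ⊗≫ 𝟙 _ := by
      rw [← whisker_exchange]; monoidal
    _ = (Δ[H] ≫ ε[H] ▷ H) ⊗≫ 𝟙 _ := by rw [comul_splitL_mul hH]; monoidal
    _ = _ := by rw [counit_comul]; monoidal

theorem id_convolution_piR (hH : IsWeakBimonoid H) : convolution (𝟙 H) (piR H) = 𝟙 H := by
  simp only [convolution, id_tensorHom, ← splitR_counit]
  calc _ = Δ[H] ≫ H ◁ splitR H ⊗≫ ((H ⊗ H) ◁ ε[H] ≫ μ[H] ▷ 𝟙_ C) ⊗≫ 𝟙 _ := by monoidal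
    _ = (Δ[H] ≫ H ◁ splitR H ≫ (α_ H H H).inv ≫ μ[H] ▷ H) ≫ H ◁ ε[H] ⊗≫ 𝟙 _ := by
      rw [whisker_exchange]; monoidal
    _ = (Δ[H] ≫ H ◁ ε[H]) ⊗≫ 𝟙 _ := by rw [comul_splitR_mul hH]; monoidal
    _ = _ := by rw [comul_counit]; monoidal

theorem unit_comul_splitL (hH : IsWeakBimonoid H) :
    (η[H] ≫ Δ[H]) ≫ H ◁ splitL H = (η[H] ≫ Δ[H]) ≫ Δ[H] ▷ H ≫ (α_ H H H).hom := by
  have h := insert_comp_braiding (Z := H) (η[H] ≫ Δ[H])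
  calc _ = (η[H] ≫ Δ[H]) ≫ H ◁ (((λ_ H).inv ≫ (η[H] ≫ Δ[H]) ▷ H ≫ (α_ H H H).hom ≫
          H ◁ (β_ H H).hom) ≫ (α_ H H H).inv ≫ μ[H] ▷ H) := by
        simp only [splitL, actFirst]; monoidal
    _ = ((λ_ (𝟙_ C)).inv ≫ ((η[H] ≫ Δ[H]) ⊗ₘ (η[H] ≫ Δ[H])) ≫
      (α_ (H ⊗ H) H H).inv ≫ (α_ H H H).hom ▷ H ≫ (H ◁ ((β_ H H).inv ≫ μ[H])) ▷ H) ≫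
        (α_ H H H).hom := by
      rw [h]; simp only [MonoidalCategory.tensorHom_def]; monoidal
    _ = _ := by rw [← hH.unit_comul_mul_braiding]; monoidal

theorem unit_comul_splitR (hH : IsWeakBimonoid H) :
    (η[H] ≫ Δ[H]) ≫ splitR H ▷ H = (η[H] ≫ Δ[H]) ≫ H ◁ Δ[H] ≫ (α_ H H H).inv := by
  have h := insert_comp_braiding' (Z := H) (η[H] ≫ Δ[H])
  calc _ = (η[H] ≫ Δ[H]) ≫ (((ρ_ H).inv ≫ H ◁ (η[H] ≫ Δ[H]) ≫ (α_ H H H).inv ≫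
          (β_ H H).hom ▷ H) ≫ (α_ H H H).hom ≫ H ◁ μ[H]) ▷ H := by
        simp only [splitR, actSecond]; monoidal
    _ = (λ_ (𝟙_ C)).inv ≫ ((η[H] ≫ Δ[H]) ⊗ₘ (η[H] ≫ Δ[H])) ≫
      (α_ (H ⊗ H) H H).inv ≫ (α_ H H H).hom ▷ H ≫ (H ◁ ((β_ H H).inv ≫ μ[H])) ▷ H := by
      rw [h]; simp only [MonoidalCategory.tensorHom_def']; monoidal
    _ = _ := by rw [← hH.unit_comul_mul_braiding]; simp

/-- Up to braidings, write `Δ(x)` as `1₁x₁ ⊗ 1₂x₂`. Then `splitL` takes `1₂x₂` to `splitL(1₂)` acted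
on by `x₂`, and `unit_comul_splitL` turns the result into `1₁x₁ ⊗ 1₂x₂ ⊗ 1₃`, which is `Δ(1₁x) ⊗
1₂`. -/
theorem comul_splitL (hH : IsWeakBimonoid H) :
    Δ[H] ≫ H ◁ splitL H = splitL H ≫ Δ[H] ▷ H ≫ (α_ H H H).hom := by
  calc _ = Δ[H] ≫ splitL H ▷ H ≫ (α_ H H H).hom ≫ H ◁ (μ[H] ≫ splitL H) := by
        nth_rewrite 1 [← comul_splitL_mul hH]; monoidal
    _ = Δ[H] ⊗≫ (η[H] ≫ Δ[H]) ▷ (H ⊗ H) ⊗≫ H ◁ (β_ H H).hom ▷ H ⊗≫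
          (μ[H] ▷ (H ⊗ H) ≫ H ◁ (splitL H ▷ H ≫ actFirst H)) := by
        rw [mul_splitL]; nth_rewrite 1 [splitL, actFirst]; monoidal
    _ = Δ[H] ⊗≫ (η[H] ≫ Δ[H]) ▷ (H ⊗ H) ⊗≫ H ◁ ((β_ H H).hom ≫ H ◁ splitL H) ▷ H ⊗≫
          (H ⊗ H) ◁ actFirst H ⊗≫ μ[H] ▷ (H ⊗ H) := by
        rw [← whisker_exchange]; monoidal
    _ = Δ[H] ⊗≫ ((η[H] ≫ Δ[H]) ≫ H ◁ splitL H) ▷ (H ⊗ H) ⊗≫ H ◁ (β_ (H ⊗ H) H).hom ▷ H ⊗≫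
          (H ⊗ H) ◁ actFirst H ⊗≫ μ[H] ▷ (H ⊗ H) := by
        rw [← BraidedCategory.braiding_naturality_left]; monoidal
    _ = (𝟙 _ ⊗≫ 𝟙_ C ◁ Δ[H] ≫ (η[H] ≫ Δ[H]) ▷ (H ⊗ H)) ⊗≫ Δ[H] ▷ (H ⊗ (H ⊗ H)) ⊗≫
          H ◁ (β_ (H ⊗ H) H).hom ▷ H ⊗≫ (H ⊗ H) ◁ actFirst H ⊗≫ μ[H] ▷ (H ⊗ H) := by
        rw [unit_comul_splitL hH]; monoidal
    _ = 𝟙 _ ⊗≫ (η[H] ≫ Δ[H]) ▷ H ⊗≫ (H ⊗ H) ◁ Δ[H] ⊗≫ Δ[H] ▷ (H ⊗ (H ⊗ H)) ⊗≫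
          H ◁ H ◁ (β_ H H).hom ▷ H ⊗≫ H ◁ ((β_ H H).hom ▷ (H ⊗ H) ≫ (H ⊗ H) ◁ (β_ H H).hom) ⊗≫
            H ◁ H ◁ μ[H] ▷ H ⊗≫ μ[H] ▷ (H ⊗ H) := by
        rw [whisker_exchange, BraidedCategory.braiding_tensor_left_hom, actFirst]; monoidal
    _ = 𝟙 _ ⊗≫ (η[H] ≫ Δ[H]) ▷ H ⊗≫ ((H ⊗ H) ◁ Δ[H] ≫ (Δ[H] ▷ H) ▷ (H ⊗ H)) ⊗≫
          H ◁ H ◁ (β_ H (H ⊗ H)).hom ⊗≫ H ◁ (β_ H H).hom ▷ H ▷ H ⊗≫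
            ((H ⊗ H) ◁ μ[H] ≫ μ[H] ▷ H) ▷ H ⊗≫ 𝟙 _ := by
        rw [← whisker_exchange, BraidedCategory.braiding_tensor_right_hom]; monoidal
    _ = 𝟙 _ ⊗≫ (η[H] ≫ Δ[H]) ▷ H ⊗≫ Δ[H] ▷ H ▷ H ⊗≫
          H ◁ H ◁ (H ◁ Δ[H] ≫ (β_ H (H ⊗ H)).hom) ⊗≫ H ◁ (β_ H H).hom ▷ H ▷ H ⊗≫
            (μ[H] ⊗ₘ μ[H]) ▷ H ⊗≫ 𝟙 _ := by
        rw [whisker_exchange, whisker_exchange μ[H] μ[H], MonoidalCategory.tensorHom_def]; monoidal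
    _ = 𝟙 _ ⊗≫ (η[H] ≫ Δ[H]) ▷ H ⊗≫ H ◁ (β_ H H).hom ⊗≫
          ((Δ[H] ⊗ₘ Δ[H]) ≫ tensorμ H H H H ≫ (μ[H] ⊗ₘ μ[H])) ▷ H ⊗≫ 𝟙 _ := by
        rw [BraidedCategory.braiding_naturality_right]
        calc _ = 𝟙 _ ⊗≫ (η[H] ≫ Δ[H]) ▷ H ⊗≫ (Δ[H] ▷ (H ⊗ H) ≫ (H ⊗ H) ◁ (β_ H H).hom) ⊗≫
              H ◁ H ◁ Δ[H] ▷ H ⊗≫ H ◁ (β_ H H).hom ▷ H ▷ H ⊗≫ (μ[H] ⊗ₘ μ[H]) ▷ H ⊗≫ 𝟙 _ := by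
              monoidal
          _ = _ := by
              rw [← whisker_exchange]
              simp only [tensorμ, MonoidalCategory.tensorHom_def]; monoidal
    _ = _ := by
        rw [← hH.mul_comul]; simp only [splitL, actFirst]; monoidal

theorem comul_splitR (hH : IsWeakBimonoid H) :
    Δ[H] ≫ splitR H ▷ H = splitR H ≫ H ◁ Δ[H] ≫ (α_ H H H).inv := by
  calc _ = Δ[H] ≫ H ◁ splitR H ≫ (α_ H H H).inv ≫ (μ[H] ≫ splitR H) ▷ H := by
        nth_rewrite 1 [← comul_splitR_mul hH]; monoidal
    _ = Δ[H] ⊗≫ (H ⊗ H) ◁ (η[H] ≫ Δ[H]) ⊗≫ H ◁ (β_ H H).hom ▷ H ⊗≫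
          ((H ⊗ H) ◁ μ[H] ≫ (H ◁ splitR H ≫ actSecond H) ▷ H) := by
        rw [mul_splitR]; nth_rewrite 1 [splitR, actSecond]; monoidal
    _ = Δ[H] ⊗≫ (H ⊗ H) ◁ (η[H] ≫ Δ[H]) ⊗≫ H ◁ ((β_ H H).hom ≫ splitR H ▷ H) ▷ H ⊗≫
          actSecond H ▷ (H ⊗ H) ⊗≫ (H ⊗ H) ◁ μ[H] := by
        rw [whisker_exchange]; monoidal
    _ = Δ[H] ⊗≫ (H ⊗ H) ◁ ((η[H] ≫ Δ[H]) ≫ splitR H ▷ H) ⊗≫ H ◁ (β_ H (H ⊗ H)).hom ▷ H ⊗≫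
          actSecond H ▷ (H ⊗ H) ⊗≫ (H ⊗ H) ◁ μ[H] := by
        rw [← BraidedCategory.braiding_naturality_right]; monoidal
    _ = (𝟙 _ ⊗≫ Δ[H] ▷ 𝟙_ C ≫ (H ⊗ H) ◁ (η[H] ≫ Δ[H])) ⊗≫ ((H ⊗ H) ⊗ H) ◁ Δ[H] ⊗≫
          H ◁ (β_ H (H ⊗ H)).hom ▷ H ⊗≫ actSecond H ▷ (H ⊗ H) ⊗≫ (H ⊗ H) ◁ μ[H] := by
        rw [unit_comul_splitR hH]; monoidal
    _ = 𝟙 _ ⊗≫ H ◁ (η[H] ≫ Δ[H]) ⊗≫ Δ[H] ▷ (H ⊗ H) ⊗≫ ((H ⊗ H) ⊗ H) ◁ Δ[H] ⊗≫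
          H ◁ (β_ H H).hom ▷ H ▷ H ⊗≫ ((H ⊗ H) ◁ (β_ H H).hom ≫ (β_ H H).hom ▷ (H ⊗ H)) ▷ H ⊗≫
            H ◁ μ[H] ▷ H ▷ H ⊗≫ (H ⊗ H) ◁ μ[H] := by
        rw [← whisker_exchange, BraidedCategory.braiding_tensor_right_hom, actSecond]; monoidal
    _ = 𝟙 _ ⊗≫ H ◁ (η[H] ≫ Δ[H]) ⊗≫ (Δ[H] ▷ (H ⊗ H) ≫ (H ⊗ H) ◁ (H ◁ Δ[H])) ⊗≫
          (β_ (H ⊗ H) H).hom ▷ H ▷ H ⊗≫ H ◁ H ◁ (β_ H H).hom ▷ H ⊗≫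
            H ◁ (μ[H] ▷ (H ⊗ H) ≫ H ◁ μ[H]) ⊗≫ 𝟙 _ := by
        rw [whisker_exchange, BraidedCategory.braiding_tensor_left_hom]; monoidal
    _ = 𝟙 _ ⊗≫ H ◁ (η[H] ≫ Δ[H]) ⊗≫ H ◁ H ◁ Δ[H] ⊗≫
          (Δ[H] ▷ H ≫ (β_ (H ⊗ H) H).hom) ▷ H ▷ H ⊗≫ H ◁ H ◁ (β_ H H).hom ▷ H ⊗≫
            H ◁ (μ[H] ⊗ₘ μ[H]) ⊗≫ 𝟙 _ := by
        rw [← whisker_exchange, MonoidalCategory.tensorHom_def]; monoidal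
    _ = 𝟙 _ ⊗≫ H ◁ (η[H] ≫ Δ[H]) ⊗≫ (β_ H H).hom ▷ H ⊗≫
          H ◁ ((Δ[H] ⊗ₘ Δ[H]) ≫ tensorμ H H H H ≫ (μ[H] ⊗ₘ μ[H])) ⊗≫ 𝟙 _ := by
        rw [BraidedCategory.braiding_naturality_left]
        calc _ = 𝟙 _ ⊗≫ H ◁ (η[H] ≫ Δ[H]) ⊗≫ ((H ⊗ H) ◁ Δ[H] ≫ (β_ H H).hom ▷ (H ⊗ H)) ⊗≫
              H ◁ Δ[H] ▷ H ▷ H ⊗≫ H ◁ H ◁ (β_ H H).hom ▷ H ⊗≫ H ◁ (μ[H] ⊗ₘ μ[H]) ⊗≫ 𝟙 _ := by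
              monoidal
          _ = _ := by
              rw [whisker_exchange]
              simp only [tensorμ, MonoidalCategory.tensorHom_def']; monoidal
    _ = _ := by
        rw [← hH.mul_comul]; simp only [splitR, actSecond]; monoidal

/-- Apply `ε` to the middle factor of `comul_splitL`. -/
theorem comul_whiskerLeft_piL (hH : IsWeakBimonoid H) : Δ[H] ≫ H ◁ piL H = splitL H := by
  calc _ = (Δ[H] ≫ H ◁ splitL H) ≫ H ◁ (ε[H] ▷ H ≫ (λ_ H).hom) := by
        rw [← splitL_counit]; monoidal
    _ = splitL H ≫ (Δ[H] ≫ H ◁ ε[H]) ▷ H ⊗≫ 𝟙 _ := by rw [comul_splitL hH]; monoidal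
    _ = _ := by rw [comul_counit]; monoidal

theorem comul_piR_whiskerRight (hH : IsWeakBimonoid H) : Δ[H] ≫ piR H ▷ H = splitR H := by
  calc _ = (Δ[H] ≫ splitR H ▷ H) ≫ (H ◁ ε[H] ≫ (ρ_ H).hom) ▷ H := by
        rw [← splitR_counit]; monoidal
    _ = splitR H ≫ H ◁ (Δ[H] ≫ ε[H] ▷ H) ⊗≫ 𝟙 _ := by rw [comul_splitR hH]; monoidal
    _ = _ := by rw [counit_comul]; monoidal

/-- Rests on `Δ(1)Δ(1) = Δ(1)`, once the factor `x` has been braided out of the way. -/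
theorem splitL_splitL (hH : IsWeakBimonoid H) :
    splitL H ≫ splitL H ▷ H ≫ (α_ H H H).hom ≫ H ◁ μ[H] = splitL H := by
  calc _ = 𝟙 _ ⊗≫ (η[H] ≫ Δ[H]) ▷ H ⊗≫ H ◁ (β_ H H).hom ⊗≫ (μ[H] ≫ splitL H) ▷ H ⊗≫
          H ◁ μ[H] := by nth_rewrite 1 [splitL, actFirst]; monoidal
    _ = 𝟙 _ ⊗≫ (η[H] ≫ Δ[H]) ▷ H ⊗≫ (H ◁ (β_ H H).hom ≫ splitL H ▷ (H ⊗ H)) ⊗≫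
          H ◁ (β_ H H).hom ▷ H ⊗≫ (μ[H] ▷ (H ⊗ H) ≫ H ◁ μ[H]) := by
        rw [mul_splitL, actFirst]; monoidal
    _ = 𝟙 _ ⊗≫ (η[H] ≫ Δ[H]) ▷ H ⊗≫ splitL H ▷ H ▷ H ⊗≫
          H ◁ ((β_ (H ⊗ H) H).hom ≫ H ◁ μ[H]) ⊗≫ μ[H] ▷ H := by
        rw [whisker_exchange, ← whisker_exchange μ[H] μ[H],
          BraidedCategory.braiding_tensor_left_hom]
        monoidal
    _ = 𝟙 _ ⊗≫ (η[H] ≫ Δ[H] ≫ splitL H ▷ H ≫ (α_ H H H).hom ≫ H ◁ μ[H]) ▷ H ⊗≫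
          H ◁ (β_ H H).hom ⊗≫ μ[H] ▷ H := by
        rw [← BraidedCategory.braiding_naturality_left]; monoidal
    _ = _ := by rw [comul_splitL_mul hH]; simp only [splitL, actFirst]; monoidal

theorem splitR_splitR (hH : IsWeakBimonoid H) :
    splitR H ≫ H ◁ splitR H ≫ (α_ H H H).inv ≫ μ[H] ▷ H = splitR H := by
  calc _ = 𝟙 _ ⊗≫ H ◁ (η[H] ≫ Δ[H]) ⊗≫ (β_ H H).hom ▷ H ⊗≫ H ◁ (μ[H] ≫ splitR H) ⊗≫
          μ[H] ▷ H := by nth_rewrite 1 [splitR, actSecond]; monoidal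
    _ = 𝟙 _ ⊗≫ H ◁ (η[H] ≫ Δ[H]) ⊗≫ ((β_ H H).hom ▷ H ≫ (H ⊗ H) ◁ splitR H) ⊗≫
          H ◁ (β_ H H).hom ▷ H ⊗≫ ((H ⊗ H) ◁ μ[H] ≫ μ[H] ▷ H) := by
        rw [mul_splitR, actSecond]; monoidal
    _ = 𝟙 _ ⊗≫ H ◁ (η[H] ≫ Δ[H]) ⊗≫ H ◁ H ◁ splitR H ⊗≫
          ((β_ H (H ⊗ H)).hom ≫ μ[H] ▷ H) ▷ H ⊗≫ H ◁ μ[H] := by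
        rw [← whisker_exchange, whisker_exchange μ[H] μ[H],
          BraidedCategory.braiding_tensor_right_hom]
        monoidal
    _ = 𝟙 _ ⊗≫ H ◁ (η[H] ≫ Δ[H] ≫ H ◁ splitR H ≫ (α_ H H H).inv ≫ μ[H] ▷ H) ⊗≫
          (β_ H H).hom ▷ H ⊗≫ H ◁ μ[H] := by
        rw [← BraidedCategory.braiding_naturality_right]; monoidal
    _ = _ := by rw [comul_splitR_mul hH]; simp only [splitR, actSecond]; monoidal

theorem piL_convolution_piL (hH : IsWeakBimonoid H) :
    convolution (piL H) (piL H) = piL H := by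
  calc _ = (Δ[H] ≫ H ◁ piL H) ≫ piL H ▷ H ≫ μ[H] := by
        simp only [convolution, MonoidalCategory.tensorHom_def']; monoidal
    _ = splitL H ≫ splitL H ▷ H ⊗≫ (ε[H] ▷ (H ⊗ H) ≫ 𝟙_ C ◁ μ[H]) ⊗≫ 𝟙 _ := by
        rw [comul_whiskerLeft_piL hH, ← splitL_counit]; monoidal
    _ = (splitL H ≫ splitL H ▷ H ≫ (α_ H H H).hom ≫ H ◁ μ[H]) ≫ ε[H] ▷ H ≫ (λ_ H).hom := by
        rw [← whisker_exchange]; monoidal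
    _ = _ := by rw [splitL_splitL hH, splitL_counit]

theorem piR_convolution_piR (hH : IsWeakBimonoid H) :
    convolution (piR H) (piR H) = piR H := by
  calc _ = (Δ[H] ≫ piR H ▷ H) ≫ H ◁ piR H ≫ μ[H] := by
        simp only [convolution, MonoidalCategory.tensorHom_def]; monoidal
    _ = splitR H ≫ H ◁ splitR H ⊗≫ ((H ⊗ H) ◁ ε[H] ≫ μ[H] ▷ 𝟙_ C) ⊗≫ 𝟙 _ := by
        rw [comul_piR_whiskerRight hH, ← splitR_counit]; monoidal
    _ = (splitR H ≫ H ◁ splitR H ≫ (α_ H H H).inv ≫ μ[H] ▷ H) ≫ H ◁ ε[H] ≫ (ρ_ H).hom := by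
        rw [whisker_exchange]; monoidal
    _ = _ := by rw [splitR_splitR hH, splitR_counit]

end Projections

end WeakHopf

/-! ### The main theorem. -/

theorem mainTheorem3 {C : Type u} [Category.{v} C] [MonoidalCategory C] [BraidedCategory C]
    [Limits.HasEqualizers C] [Limits.HasCoequalizers C]
    (H : C) [MonObj H] [ComonObj H] (hH : WeakHopf.IsWeakBimonoid H) :
    (Nonempty (WeakHopf.Splitting (WeakHopf.omegaL1 H)) ∧
      Nonempty (WeakHopf.Splitting (WeakHopf.omegaR1 H)) ∧
      Nonempty (WeakHopf.Splitting (WeakHopf.omegaL2 H)) ∧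
      Nonempty (WeakHopf.Splitting (WeakHopf.omegaR2 H))) ∧
    (∀ (sL1 : WeakHopf.Splitting (WeakHopf.omegaL1 H))
      (sR1 : WeakHopf.Splitting (WeakHopf.omegaR1 H))
      (sL2 : WeakHopf.Splitting (WeakHopf.omegaL2 H))
      (sR2 : WeakHopf.Splitting (WeakHopf.omegaR2 H)),
      List.TFAE [WeakHopf.IsWeakHopfAlgebra H,
        IsIso (WeakHopf.galoisF sL1 sR1),
        IsIso (WeakHopf.galoisG sR2 sL2)]) := by
  open WeakHopf in
  have hLL := piL_convolution_piL hH
  have hRR := piR_convolution_piR hH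
  have hL := piL_convolution_id hH
  have hR := id_convolution_piR hH
  refine ⟨⟨nonempty_splitting ?_, nonempty_splitting ?_, nonempty_splitting ?_,
    nonempty_splitting ?_⟩, fun sL1 sR1 sL2 sR2 => ?_⟩
  · rw [omegaOne_comp, hLL]
  · rw [omegaOne_comp, hRR]
  · rw [omegaTwo_comp, hLL]
  · rw [omegaTwo_comp, hRR]
  · have hS : IsWeakHopfAlgebra H ↔ ∃ S : H ⟶ H, IsAntipode S :=
      ⟨fun h => h.exists_antipode, fun h => ⟨hH, h⟩⟩
    rw [exists_isAntipode_iff] at hS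
    tfae_have 1 ↔ 2 := by
      -- What remains is the compatibility of `β` with the two idempotents: `Π^L ∗ id = id` and `id
      -- ∗ Π^R = id`.
      rw [hS, galoisF, ← omegaOne_id, isIso_splitting_iff, exists_isRelativeInverse_omegaOne_iff]
      · rw [omegaOne_comp, hL]
      · rw [omegaOne_comp, hR]
    tfae_have 1 ↔ 3 := by
      rw [hS, galoisG, ← omegaTwo_id, isIso_splitting_iff, exists_isRelativeInverse_omegaTwo_iff]
      · rw [omegaTwo_comp, hR]
      · rw [omegaTwo_comp, hL]
    tfae_finish
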